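/- Let $T>0$ and let $U:\mathbb{R}\times\mathbb{R}^2\to\mathbb{R}$ be a $C^1$ function that is $T$-periodic in its first variable and satisfies, for some $C>0$ and $\alpha\in(0,2)$, $$|U(t,x)|\le C\,(1+|x|^\alpha)\qquad\text{for every }(t,x)\in\mathbb{R}\times\mathbb{R}^2 .$$ Let $H^1_T$ be the space of (continuous representatives of) $H^1$ functions $x:[0,T]\to\mathbb{R}^2$ with $x(0)=x(T)$. For $x\in H^1_T$ without zeros, written in polar coordinates as $x(t)=\rho(t)e^{i\theta(t)}$ with $\rho=|x|>0$ and $\theta$ continuous on $[0,T]$, let $r_x=\frac{\theta(T)-\theta(0)}{2\pi}$ be its winding number around the origin. Put $$\mathcal{X}_c=\{x\in H^1_T:\ x(t_0)=0\text{ for some }t_0\in[0,T]\},$$ $$\mathcal{X}_r=\{x\in H^1_T:\ x(t)\ne0\ \text{for all } t\in[0,T]\text{ and } r_x\neq0\},$$ $$\mathcal{X}=\mathcal{X}_c\cup\mathcal{X}_r,$$ and define $A_T:\mathcal{X}\to(-\infty,+\infty]$ by $$A_T(x)=\int_0^T\Big(\tfrac12|\dot x(t)|^2+\tfrac1{|x(t)|}+U(t,x(t))\Big)\,dt,$$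 where $\dot x$ is the weak derivative of $x$ and $1/|x(t)|=+\infty$ when $x(t)=0$. Then $A_T$ attains its minimum on $\mathcal{X}$: there exists $x\in\mathcal{X}$ such that $$A_T(x)=\min_{y\in\mathcal{X}}A_T(y).$$ -/

import Mathlib

open MeasureTheory Set
open scoped ContDiff ENNReal

namespace ForcedKepler

/-- The Euclidean plane. -/
abbrev Plane : Type := EuclideanSpace ℝ (Fin 2)

/-- `v` belongs to `L²(0,T)` and is the weak (distributional) derivative of `x` on `(0,T)`:
`∫ φ' x = - ∫ φ v` for every smooth real test function `φ` with compact support in `(0,T)`. -/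
def IsWeakDeriv (T : ℝ) (x v : ℝ → Plane) : Prop :=
  MemLp v 2 (volume.restrict (Ioo 0 T)) ∧
    ∀ φ : ℝ → ℝ, ContDiff ℝ ∞ φ → HasCompactSupport φ → tsupport φ ⊆ Ioo 0 T →
      ∫ t in Ioo 0 T, deriv φ t • x t = - ∫ t in Ioo 0 T, φ t • v t

/-- The space `H¹_T` of `H¹` functions `x : [0,T] → ℝ²` with `x(0) = x(T)`. As usual, an `H¹`
function on an interval is identified with its representative that is continuous on `[0,T]`
(so that it is in particular in `L²`). Functions on `[0,T]` are modelled as functions on `ℝ` of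
which only the values on `[0,T]` are ever used. -/
def H1Loop (T : ℝ) : Set (ℝ → Plane) :=
  {x | ContinuousOn x (Icc 0 T) ∧ x 0 = x T ∧ ∃ v, IsWeakDeriv T x v}

open Classical in
/-- The `L²` weak derivative `ẋ` of `x` on `(0,T)`. It is unique up to a null set, so any choice
gives the same integrals. It is only used for `x ∈ H1Loop T`. -/
noncomputable def weakDeriv (T : ℝ) (x : ℝ → Plane) : ℝ → Plane :=
  if h : ∃ v, IsWeakDeriv T x v then h.choose else 0

/-- `θ` is a continuous polar angle along `x` on `[0,T]`, that is, `x = ρ e^{iθ}` with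
`ρ = |x|`. -/
def IsPolarAngle (T : ℝ) (x : ℝ → Plane) (θ : ℝ → ℝ) : Prop :=
  ContinuousOn θ (Icc 0 T) ∧
    ∀ t ∈ Icc 0 T, x t = ‖x t‖ • (!₂[Real.cos (θ t), Real.sin (θ t)] : Plane)

/-- `r` is the winding number around the origin, `(θ(T) - θ(0)) / (2π)`, of the loop `x`. For
`x` continuous and zero-free on `[0,T]` there is exactly one such `r`, independent of the polar
angle. -/
def HasWindingNumber (T : ℝ) (x : ℝ → Plane) (r : ℝ) : Prop :=
  ∃ θ : ℝ → ℝ, IsPolarAngle T x θ ∧ r = (θ T - θ 0) / (2 * Real.pi)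

/-- The loops in `H¹_T` that hit the origin. -/
def collisionLoops (T : ℝ) : Set (ℝ → Plane) :=
  {x | x ∈ H1Loop T ∧ ∃ t₀ ∈ Icc 0 T, x t₀ = 0}

/-- The loops in `H¹_T` that avoid the origin and have nonzero winding number around it. -/
def windingLoops (T : ℝ) : Set (ℝ → Plane) :=
  {x | x ∈ H1Loop T ∧ (∀ t ∈ Icc 0 T, x t ≠ 0) ∧ ∃ r : ℝ, HasWindingNumber T x r ∧ r ≠ 0}

/-- The class `𝒳` on which the action is minimized. -/
def loopClass (T : ℝ) : Set (ℝ → Plane) :=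
  collisionLoops T ∪ windingLoops T

/-- The action `∫₀ᵀ (½|ẋ|² + 1/|x| + U(t,x)) dt`, with values in `(-∞, +∞]`. The nonnegative part
`½|ẋ|² + 1/|x|` is integrated as a `[0,∞]`-valued function, with `1/|x(t)| = +∞` at collisions
`x(t) = 0`; the term `U(t,x(t))` is continuous on `[0,T]` and has a finite integral. -/
noncomputable def action (T : ℝ) (U : ℝ × Plane → ℝ) (x : ℝ → Plane) : EReal :=
  ((∫⁻ t in Ioo 0 T, (‖weakDeriv T x t‖ₑ ^ 2 / 2 + ‖x t‖ₑ⁻¹) : ℝ≥0∞) : EReal)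
    + ((∫ t in Ioo 0 T, U (t, x t) : ℝ) : EReal)

end ForcedKepler

namespace ForcedKepler

open Filter Topology
open scoped InnerProductSpace

/-! The proof is the direct method. The class excludes zero-free loops of winding number zero, the
ones that could escape to infinity with small velocity. A colliding loop is anchored at the origin,
and a winding loop meets the ray opposite to its starting point, so in both cases `‖x‖_∞` is at most
a constant times `‖ẋ‖` in `L²` (`norm_le_velocity`). As `U` grows subquadratically, the kinetic term
dominates it, and sublevels of the action are bounded in `H¹` (`exists_velocity_bound`).

A minimizing sequence then has a subsequence converging uniformly, with velocities converging weakly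
in `L²` (`exists_subseq_tendsto`). The class is closed under such limits: a limit without zeros
inherits the nonzero winding number, and a limit with a zero is a collision loop
(`mem_loopClass_of_tendstoUniformlyOn`). The action is lower semicontinuous
(`action_le_of_tendsto`): convexity handles the kinetic term, Fatou the singular term, dominated
convergence the potential. -/

/-- Bounded sequences in a separable Hilbert space have weakly convergent subsequences. -/
lemma exists_subseq_tendsto_inner {H : Type*} [NormedAddCommGroup H] [InnerProductSpace ℝ H]
    [CompleteSpace H] [TopologicalSpace.SeparableSpace H] (u : ℕ → H) (R : ℝ)
    (hu : ∀ n, ‖u n‖ ≤ R) :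
    ∃ (v : H) (φ : ℕ → ℕ), StrictMono φ ∧
      ∀ w, Tendsto (fun n => ⟪w, u (φ n)⟫_ℝ) atTop (𝓝 ⟪w, v⟫_ℝ) := by
  have hb := WeakDual.isSeqCompact_closedBall (𝕜 := ℝ) (E := H) 0 R
  obtain ⟨f, -, φ, hφ, hlim⟩ := hb
    (x := fun n => StrongDual.toWeakDual (InnerProductSpace.toDual ℝ H (u n))) (by
      intro n
      simpa using hu n)
  refine ⟨(InnerProductSpace.toDual ℝ H).symm (WeakDual.toStrongDual f), φ, hφ, fun w => ?_⟩
  have h1 := ((WeakDual.eval_continuous (𝕜 := ℝ) (E := H) w).tendsto f).comp hlim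
  have h2 : ⟪w, (InnerProductSpace.toDual ℝ H).symm (WeakDual.toStrongDual f)⟫_ℝ = f w := by
    rw [real_inner_comm, InnerProductSpace.toDual_symm_apply]; rfl
  rw [h2]
  refine h1.congr fun n => ?_
  change InnerProductSpace.toDual ℝ H (u (φ n)) w = _
  rw [InnerProductSpace.toDual_apply_apply, real_inner_comm]

/-! ### Test functions and the du Bois-Reymond lemma -/

variable {T : ℝ}

lemma integral_deriv_Ioi {φ : ℝ → ℝ} (hφ : ContDiff ℝ ∞ φ) (hs : tsupport φ ⊆ Ioo 0 T) {s : ℝ}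
    (h0 : s ∈ Ioo 0 T) : ∫ t in Ioi s, deriv φ t ∂(volume.restrict (Ioo 0 T)) = -φ s := by
  rw [Measure.restrict_restrict measurableSet_Ioi]
  have h1 : Ioi s ∩ Ioo 0 T = Ioo s T := by
    ext t; simp only [mem_inter_iff, mem_Ioi, mem_Ioo]
    constructor
    · rintro ⟨a, b, c⟩; exact ⟨a, c⟩
    · rintro ⟨a, b⟩; exact ⟨a, h0.1.trans a, b⟩
  have hT : φ T = 0 := by
    by_contra h
    exact lt_irrefl _ (hs (subset_tsupport _ h)).2
  rw [h1, ← integral_Ioc_eq_integral_Ioo, ← intervalIntegral.integral_of_le h0.2.le,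
    intervalIntegral.integral_deriv_eq_sub
      (fun t _ => (hφ.differentiable (by simp)).differentiableAt)
      ((hφ.continuous_deriv (by simp)).intervalIntegrable _ _), hT, zero_sub]

/-- Integration by parts for the primitive of an integrable function. -/
lemma integral_deriv_smul_primitive {E : Type*} [NormedAddCommGroup E] [NormedSpace ℝ E]
    [CompleteSpace E] {v : ℝ → E}
    (hv : Integrable v (volume.restrict (Ioo 0 T))) {φ : ℝ → ℝ} (hφ : ContDiff ℝ ∞ φ)
    (hs : tsupport φ ⊆ Ioo 0 T) (hc : HasCompactSupport φ) :
    ∫ t in Ioo 0 T, deriv φ t • (∫ s in Iio t, v s ∂(volume.restrict (Ioo 0 T)))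
      = -∫ t in Ioo 0 T, φ t • v t := by
  set μ := volume.restrict (Ioo 0 T) with hμ
  have hdc : Continuous (deriv φ) := hφ.continuous_deriv (by simp)
  have hi : Integrable (deriv φ) μ :=
    (hdc.integrable_of_hasCompactSupport hc.deriv).restrict
  -- Fubini on the triangle `s < t`: integrating in `t` first leaves `∫ φ'` over `(s, T)`, which is
  -- `-φ s`.
  have hF : Integrable ({p : ℝ × ℝ | p.2 < p.1}.indicator fun p => deriv φ p.1 • v p.2)
      (μ.prod μ) :=
    (hi.smul_prod hv).indicator (measurableSet_lt measurable_snd measurable_fst)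
  calc ∫ t, deriv φ t • (∫ s in Iio t, v s ∂μ) ∂μ
      = ∫ t, ∫ s, {p : ℝ × ℝ | p.2 < p.1}.indicator (fun p => deriv φ p.1 • v p.2) (t, s)
          ∂μ ∂μ := by
        refine integral_congr_ae (Eventually.of_forall fun t => ?_)
        simp only
        rw [← integral_smul, ← integral_indicator measurableSet_Iio]
        rfl
    _ = ∫ s, ∫ t, {p : ℝ × ℝ | p.2 < p.1}.indicator (fun p => deriv φ p.1 • v p.2) (t, s)
          ∂μ ∂μ := integral_integral_swap hF
    _ = ∫ s, (∫ t in Ioi s, deriv φ t ∂μ) • v s ∂μ := by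
        refine integral_congr_ae (Eventually.of_forall fun s => ?_)
        simp only
        rw [← integral_smul_const, ← integral_indicator measurableSet_Ioi]
        rfl
    _ = ∫ s, -(φ s • v s) ∂μ := by
        refine setIntegral_congr_fun measurableSet_Ioo fun s h0 => ?_
        rw [integral_deriv_Ioi hφ hs h0, neg_smul]
    _ = _ := integral_neg _

/-- The primitive of a smooth function with zero mean and compact support in an interval is again
a test function. -/
lemma exists_primitive_testFunction {h : ℝ → ℝ} (hh : ContDiff ℝ ∞ h) {a b : ℝ}
    (hab : a ≤ b) (hs : ∀ t, t ∉ Icc a b → h t = 0) (h0 : ∫ t, h t = 0) :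
    ∃ φ : ℝ → ℝ, ContDiff ℝ ∞ φ ∧ tsupport φ ⊆ Icc a b ∧ deriv φ = h := by
  have hd : ∀ t, HasDerivAt (fun t => ∫ s in a..t, h s) (h t) t := fun t =>
    intervalIntegral.integral_hasDerivAt_right (hh.continuous.intervalIntegrable _ _)
      (hh.continuous.stronglyMeasurableAtFilter _ _) hh.continuous.continuousAt
  have hderiv : deriv (fun t => ∫ s in a..t, h s) = h := funext fun t => (hd t).deriv
  refine ⟨fun t => ∫ s in a..t, h s, ?_, ?_, hderiv⟩
  · rw [contDiff_infty_iff_deriv, hderiv]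
    exact ⟨fun t => (hd t).differentiableAt, hh⟩
  · refine closure_minimal (fun t ht => ?_) isClosed_Icc
    by_contra hn
    apply ht
    simp only [mem_Icc, not_and_or, not_le] at hn
    rcases hn with hn | hn
    · simp only
      rw [intervalIntegral.integral_symm, intervalIntegral.integral_of_le hn.le,
        integral_Ioc_eq_integral_Ioo,
        setIntegral_eq_zero_of_forall_eq_zero, neg_zero]
      intro s hs'
      exact hs s fun h' => not_lt.2 h'.1 hs'.2
    -- Beyond `b` the primitive equals the full integral of `h`, so the zero mean is what makes it
    -- vanish.
    · simp only
      rw [intervalIntegral.integral_of_le (hab.trans hn.le), ← h0, ← integral_Icc_eq_integral_Ioc]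
      refine setIntegral_eq_integral_of_forall_compl_eq_zero fun s hs' => hs s fun h' => hs' ?_
      exact ⟨h'.1, h'.2.trans hn.le⟩

lemma exists_Icc_of_compact_subset {K : Set ℝ} (hK : IsCompact K) (hne : K.Nonempty)
    (hs : K ⊆ Ioo 0 T) : ∃ a b, a ≤ b ∧ K ⊆ Icc a b ∧ Icc a b ⊆ Ioo 0 T := by
  refine ⟨sInf K, sSup K, Real.sInf_le_sSup _ hK.bddBelow hK.bddAbove, fun t ht =>
    ⟨csInf_le hK.bddBelow ht, le_csSup hK.bddAbove ht⟩, fun t ht => ⟨?_, ?_⟩⟩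
  · exact (hs (hK.sInf_mem hne)).1.trans_le ht.1
  · exact ht.2.trans_lt (hs (hK.sSup_mem hne)).2

lemma ae_eq_zero_of_integral_testFunction {E : Type*} [NormedAddCommGroup E] [NormedSpace ℝ E]
    [CompleteSpace E] {f : ℝ → E} (hf : IntegrableOn f (Ioo 0 T))
    (h : ∀ φ : ℝ → ℝ, ContDiff ℝ ∞ φ → HasCompactSupport φ → tsupport φ ⊆ Ioo 0 T →
      ∫ t in Ioo 0 T, φ t • f t = 0) : f =ᵐ[volume.restrict (Ioo 0 T)] 0 := by
  refine (ae_restrict_iff' measurableSet_Ioo).2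
    (isOpen_Ioo.ae_eq_zero_of_integral_contDiff_smul_eq_zero hf.locallyIntegrableOn ?_)
  intro φ hφ hc hs
  rw [← h φ hφ hc hs]
  refine (setIntegral_eq_integral_of_forall_compl_eq_zero fun t ht => ?_).symm
  have : φ t = 0 := by
    by_contra hn; exact ht (hs (subset_tsupport _ hn))
  rw [this, zero_smul]

/-- A continuous function whose weak derivative vanishes is constant. -/
lemma eq_of_weakDeriv_eq_zero {E : Type*} [NormedAddCommGroup E] [NormedSpace ℝ E]
    [CompleteSpace E] (hT : 0 < T) {x : ℝ → E} (hx : ContinuousOn x (Icc 0 T))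
    (h : ∀ φ : ℝ → ℝ, ContDiff ℝ ∞ φ → HasCompactSupport φ → tsupport φ ⊆ Ioo 0 T →
      ∫ t in Ioo 0 T, deriv φ t • x t = 0) : ∀ t ∈ Icc 0 T, x t = x 0 := by
  have hxi : IntegrableOn x (Ioo 0 T) := hx.integrableOn_Icc.mono_set Ioo_subset_Icc_self
  let f : ContDiffBump (T / 2) := ⟨T / 8, T / 4, by linarith, by linarith⟩
  set η : ℝ → ℝ := f.normed volume
  have hηs : tsupport η ⊆ Ioo 0 T := by
    rw [f.tsupport_normed_eq, Real.closedBall_eq_Icc]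
    intro t ht
    change t ∈ Icc (T / 2 - T / 4) (T / 2 + T / 4) at ht
    exact ⟨by linarith [ht.1], by linarith [ht.2]⟩
  have hηc : HasCompactSupport η := f.hasCompactSupport_normed
  have hηd : ContDiff ℝ ∞ η := f.contDiff_normed
  have hη1 : ∫ t, η t = 1 := f.integral_normed
  have hint : ∀ g : ℝ → ℝ, ContDiff ℝ ∞ g → HasCompactSupport g →
      IntegrableOn (fun t => g t • x t) (Ioo 0 T) := fun g hg hgc =>
    ((hg.continuous.continuousOn (s := Icc 0 T)).smul hx).integrableOn_Icc.mono_set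
      Ioo_subset_Icc_self
  -- The candidate constant is the mean of `x` against a bump of mass one.
  set c : E := ∫ t in Ioo 0 T, η t • x t
  have key : ∀ g : ℝ → ℝ, ContDiff ℝ ∞ g → HasCompactSupport g → tsupport g ⊆ Ioo 0 T →
      ∫ t in Ioo 0 T, g t • (x t - c) = 0 := by
    intro g hg hgc hgs
    set m := ∫ t, g t
    have hK : IsCompact (tsupport g ∪ tsupport η) := hgc.isCompact.union hηc.isCompact
    have hne : (tsupport g ∪ tsupport η).Nonempty := by
      by_contra hemp
      rw [not_nonempty_iff_eq_empty, union_empty_iff] at hemp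
      have : η = 0 := tsupport_eq_empty_iff.1 hemp.2
      rw [this] at hη1
      simp at hη1
    obtain ⟨a, b, hab, hKs, hIs⟩ := exists_Icc_of_compact_subset hK hne
      (union_subset hgs hηs)
    have hgi : Integrable g := hg.continuous.integrable_of_hasCompactSupport hgc
    have hηi : Integrable η := hηd.continuous.integrable_of_hasCompactSupport hηc
    -- Subtracting `m * η` gives `g` zero mean, hence makes it the derivative of an admissible test
    -- function; the hypothesis then yields `∫ g x = m c`.
    obtain ⟨φ, hφ, hφs, hφd⟩ := exists_primitive_testFunction (h := fun t => g t - m * η t)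
      (hg.sub (contDiff_const.mul hηd)) hab (by
        intro t ht
        have h1 : g t = 0 := by
          by_contra hn; exact ht (hKs (Or.inl (subset_tsupport _ hn)))
        have h2 : η t = 0 := by
          by_contra hn; exact ht (hKs (Or.inr (subset_tsupport _ hn)))
        simp [h1, h2]) (by
        rw [integral_sub hgi (hηi.const_mul m), integral_const_mul, hη1, mul_one, sub_self])
    have h3 := h φ hφ (isCompact_Icc.of_isClosed_subset (isClosed_tsupport _) hφs)
      (hφs.trans hIs)
    rw [hφd] at h3
    simp only [sub_smul, mul_smul] at h3
    have h5 : IntegrableOn (fun t => m • η t • x t) (Ioo 0 T) := (hint η hηd hηc).smul m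
    rw [integral_sub (hint g hg hgc) h5, integral_smul] at h3
    simp only [smul_sub]
    rw [integral_sub (hint g hg hgc) (hgi.integrableOn.smul_const c), integral_smul_const]
    have h4 : ∫ t in Ioo 0 T, g t = m :=
      setIntegral_eq_integral_of_forall_compl_eq_zero fun t ht => by
        by_contra hn; exact ht (hgs (subset_tsupport _ hn))
    rw [h4]; exact h3
  have hae := ae_eq_zero_of_integral_testFunction
    (f := fun t => x t - c) (hxi.sub (integrableOn_const (by simp))) key
  have heq : EqOn x (fun _ => c) (Icc 0 T) := by
    refine Measure.eqOn_Icc_of_ae_eq volume hT.ne ?_ hx continuousOn_const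
    rw [← Measure.restrict_congr_set Ioo_ae_eq_Icc]
    exact hae.mono fun t ht => sub_eq_zero.1 ht
  intro t ht
  rw [heq ht, heq ⟨le_rfl, hT.le⟩]

/-! ### Weak derivatives and primitives -/

variable {x : ℝ → Plane}

lemma isWeakDeriv_weakDeriv (hx : x ∈ H1Loop T) : IsWeakDeriv T x (weakDeriv T x) := by
  have h := hx.2.2
  rw [weakDeriv, dif_pos h]
  exact h.choose_spec

lemma IsWeakDeriv.integrable {v : ℝ → Plane} (hv : IsWeakDeriv T x v) :
    Integrable v (volume.restrict (Ioo 0 T)) := hv.1.integrable (by norm_num)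

lemma integrableOn_smul_of_continuous {v : ℝ → Plane} {φ : ℝ → ℝ} (hφ : Continuous φ)
    (hc : HasCompactSupport φ) (hv : IntegrableOn v (Ioo 0 T)) :
    IntegrableOn (fun t => φ t • v t) (Ioo 0 T) := by
  obtain ⟨K, hK⟩ := hc.exists_bound_of_continuous hφ
  exact Integrable.bdd_smul hv K hφ.aestronglyMeasurable (Eventually.of_forall hK)

lemma IsWeakDeriv.ae_eq {v w : ℝ → Plane} (hv : IsWeakDeriv T x v) (hw : IsWeakDeriv T x w) :
    v =ᵐ[volume.restrict (Ioo 0 T)] w := by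
  have h := ae_eq_zero_of_integral_testFunction (f := v - w) (hv.integrable.sub hw.integrable) (by
    intro φ hφ hc hs
    simp only [Pi.sub_apply, smul_sub]
    rw [integral_sub (integrableOn_smul_of_continuous hφ.continuous hc hv.integrable)
      (integrableOn_smul_of_continuous hφ.continuous hc hw.integrable)]
    have h1 := hv.2 φ hφ hc hs
    rw [hw.2 φ hφ hc hs, neg_inj] at h1
    rw [h1, sub_self])
  exact h.mono fun t ht => sub_eq_zero.1 ht

/-- The primitive on `[0,T]` of a function `v` on `(0,T)`. -/
noncomputable def primitive (T : ℝ) (v : ℝ → Plane) (t : ℝ) : Plane :=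
  ∫ s in Iio t, v s ∂(volume.restrict (Ioo 0 T))

lemma primitive_sub {v : ℝ → Plane} (hv : Integrable v (volume.restrict (Ioo 0 T))) {s t : ℝ}
    (hst : s ≤ t) :
    primitive T v t - primitive T v s = ∫ r in Ico s t, v r ∂(volume.restrict (Ioo 0 T)) := by
  rw [primitive, primitive, ← Iio_union_Ico_eq_Iio hst, setIntegral_union _ measurableSet_Ico
    hv.integrableOn hv.integrableOn, add_sub_cancel_left]
  exact Set.disjoint_left.2 fun r hr hr' => not_le.2 hr hr'.1

lemma primitive_zero (v : ℝ → Plane) : primitive T v 0 = 0 := by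
  rw [primitive, Measure.restrict_restrict measurableSet_Iio]
  have : Iio 0 ∩ Ioo 0 T = ∅ := by
    ext t; simp only [mem_inter_iff, mem_Iio, mem_Ioo, mem_empty_iff_false, iff_false]
    rintro ⟨h, h', -⟩; exact lt_asymm h h'
  rw [this]; simp

/-- Cauchy-Schwarz for `v` against the indicator of `s` times the integral `c` itself: the pairing
is `‖c‖ ^ 2`, and one factor `‖c‖` cancels. -/
lemma norm_setIntegral_le (v : Lp Plane 2 (volume.restrict (Ioo 0 T))) {s : Set ℝ}
    (hs : MeasurableSet s) :
    ‖∫ r in s, v r ∂(volume.restrict (Ioo 0 T))‖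
      ≤ √((volume.restrict (Ioo 0 T)).real s) * ‖v‖ := by
  set c := ∫ r in s, v r ∂(volume.restrict (Ioo 0 T))
  have hμ : (volume.restrict (Ioo 0 T)) s ≠ ⊤ := measure_ne_top _ _
  have h1 := L2.inner_indicatorConstLp_eq_inner_setIntegral ℝ hs hμ c v
  have h2 := real_inner_le_norm (indicatorConstLp 2 hs hμ c) v
  rw [h1, norm_indicatorConstLp (by norm_num) (by norm_num), real_inner_self_eq_norm_sq] at h2
  simp only [ENNReal.toReal_ofNat] at h2
  rw [← Real.sqrt_eq_rpow] at h2
  rcases (norm_nonneg c).eq_or_lt with h | h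
  · rw [← h]; positivity
  · refine le_of_mul_le_mul_left ?_ h
    linarith

/-- Primitives of `L²` functions are `1/2`-Hölder. -/
lemma norm_primitive_sub_le (v : Lp Plane 2 (volume.restrict (Ioo 0 T))) (s t : ℝ) :
    ‖primitive T v t - primitive T v s‖ ≤ √|t - s| * ‖v‖ := by
  wlog hst : s ≤ t generalizing s t
  · rw [norm_sub_rev, abs_sub_comm]; exact this t s (not_le.1 hst).le
  have hv : Integrable v (volume.restrict (Ioo 0 T)) := (Lp.memLp v).integrable (by norm_num)
  rw [primitive_sub hv hst]
  refine (norm_setIntegral_le v measurableSet_Ico).trans ?_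
  gcongr
  rw [abs_of_nonneg (sub_nonneg.2 hst)]
  calc (volume.restrict (Ioo 0 T)).real (Ico s t) ≤ volume.real (Ico s t) :=
        ENNReal.toReal_mono (by simp) (Measure.restrict_apply_le _ _)
    _ = t - s := Real.volume_real_Ico_of_le hst

lemma continuous_primitive (v : Lp Plane 2 (volume.restrict (Ioo 0 T))) :
    Continuous (primitive T v) := by
  rw [continuous_iff_continuousAt]
  intro s
  rw [ContinuousAt, tendsto_iff_norm_sub_tendsto_zero]
  refine squeeze_zero (fun _ => norm_nonneg _) (fun t => norm_primitive_sub_le v s t) ?_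
  have : Continuous fun t => √|t - s| * ‖v‖ := by fun_prop
  simpa using this.tendsto s

/-- Integration by parts treats the primitive, and the constant drops out because `∫ φ' = 0`. -/
lemma isWeakDeriv_of_eq_primitive {v : ℝ → Plane} (hv : MemLp v 2 (volume.restrict (Ioo 0 T)))
    (c : Plane) (hx : ∀ t ∈ Icc 0 T, x t = c + primitive T v t) : IsWeakDeriv T x v := by
  refine ⟨hv, fun φ hφ hc hs => ?_⟩
  have hvi : Integrable v (volume.restrict (Ioo 0 T)) := hv.integrable (by norm_num)
  rw [← integral_deriv_smul_primitive hvi hφ hs hc]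
  have hdc : Continuous (deriv φ) := hφ.continuous_deriv (by simp)
  have hp : ContinuousOn (primitive T v) (Icc 0 T) := by
    have h := continuous_primitive (hv.toLp v)
    have : primitive T (hv.toLp v) = primitive T v := funext fun t =>
      integral_congr_ae (ae_restrict_of_ae hv.coeFn_toLp)
    rw [this] at h; exact h.continuousOn
  have hi : IntegrableOn (fun t => deriv φ t • primitive T v t) (Ioo 0 T) :=
    (hdc.continuousOn.smul hp).integrableOn_Icc.mono_set Ioo_subset_Icc_self
  have hi' : IntegrableOn (deriv φ) (Ioo 0 T) :=
    hdc.continuousOn.integrableOn_Icc.mono_set Ioo_subset_Icc_self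
  have h0 : ∫ t in Ioo 0 T, deriv φ t = 0 := by
    rw [setIntegral_eq_integral_of_forall_compl_eq_zero fun t ht => ?_]
    · exact integral_eq_zero_of_hasDerivAt_of_integrable
        (fun t => ((hφ.differentiable (by simp)) t).hasDerivAt)
        (hdc.integrable_of_hasCompactSupport hc.deriv)
        (hφ.continuous.integrable_of_hasCompactSupport hc)
    · by_contra hn
      exact ht (hs (support_deriv_subset hn))
  calc ∫ t in Ioo 0 T, deriv φ t • x t
      = ∫ t in Ioo 0 T, (deriv φ t • c + deriv φ t • primitive T v t) :=
        setIntegral_congr_fun measurableSet_Ioo fun t ht => by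
          simp only [hx t (Ioo_subset_Icc_self ht), smul_add]
    _ = _ := by
        rw [integral_add (hi'.smul_const c) hi, integral_smul_const, h0, zero_smul, zero_add]
        rfl

/-- The difference between `x` and the primitive is continuous with zero weak derivative, hence
constant. This turns `L²` information on the velocity into pointwise information on the loop. -/
lemma IsWeakDeriv.eq_primitive (hT : 0 < T) (hx : ContinuousOn x (Icc 0 T)) {v : ℝ → Plane}
    (hv : IsWeakDeriv T x v) : ∀ t ∈ Icc 0 T, x t = x 0 + primitive T v t := by
  have hp := isWeakDeriv_of_eq_primitive (x := primitive T v) hv.1 0 (by simp)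
  have hpc : Continuous (primitive T v) := by
    have h := continuous_primitive (hv.1.toLp v)
    have : primitive T (hv.1.toLp v) = primitive T v := funext fun t =>
      integral_congr_ae (ae_restrict_of_ae hv.1.coeFn_toLp)
    rwa [this] at h
  have h := eq_of_weakDeriv_eq_zero hT (hx.sub hpc.continuousOn) (by
    intro φ hφ hc hs
    have hi : ∀ y : ℝ → Plane, ContinuousOn y (Icc 0 T) →
        IntegrableOn (fun t => deriv φ t • y t) (Ioo 0 T) := fun y hy =>
      (((hφ.continuous_deriv (by simp)).continuousOn (s := Icc 0 T)).smul
        hy).integrableOn_Icc.mono_set Ioo_subset_Icc_self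
    simp only [Pi.sub_apply, smul_sub]
    rw [integral_sub (hi x hx) (hi _ hpc.continuousOn), hv.2 φ hφ hc hs, hp.2 φ hφ hc hs, sub_self])
  intro t ht
  have := h t ht
  simp only [Pi.sub_apply, primitive_zero, sub_zero] at this
  rw [← this]; abel

/-! ### Velocities and compactness in `H¹_T` -/

/-- The weak derivative of an `H¹` loop as an element of `L²(0,T)`. -/
noncomputable def velocity (hx : x ∈ H1Loop T) : Lp Plane 2 (volume.restrict (Ioo 0 T)) :=
  (isWeakDeriv_weakDeriv hx).1.toLp _

lemma velocity_ae_eq (hx : x ∈ H1Loop T) :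
    velocity hx =ᵐ[volume.restrict (Ioo 0 T)] weakDeriv T x := MemLp.coeFn_toLp _

lemma eq_primitive_velocity (hT : 0 < T) (hx : x ∈ H1Loop T) {t : ℝ} (ht : t ∈ Icc 0 T) :
    x t = x 0 + primitive T (velocity hx) t := by
  rw [(isWeakDeriv_weakDeriv hx).eq_primitive hT hx.1 t ht]
  congr 1
  exact integral_congr_ae (ae_restrict_of_ae (velocity_ae_eq hx).symm)

lemma norm_sub_le_velocity (hT : 0 < T) (hx : x ∈ H1Loop T) {s t : ℝ} (hs : s ∈ Icc 0 T)
    (ht : t ∈ Icc 0 T) : ‖x t - x s‖ ≤ √|t - s| * ‖velocity hx‖ := by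
  rw [eq_primitive_velocity hT hx ht, eq_primitive_velocity hT hx hs, add_sub_add_left_eq_sub]
  exact norm_primitive_sub_le _ s t

lemma norm_sub_le_sqrt_mul_velocity (hT : 0 < T) (hx : x ∈ H1Loop T) {s t : ℝ} (hs : s ∈ Icc 0 T)
    (ht : t ∈ Icc 0 T) : ‖x t - x s‖ ≤ √T * ‖velocity hx‖ := by
  refine (norm_sub_le_velocity hT hx hs ht).trans ?_
  gcongr
  rw [abs_le]
  constructor <;> linarith [hs.1, hs.2, ht.1, ht.2]

lemma tendsto_plane {u : ℕ → Plane} {l : Plane}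
    (h : ∀ c : Plane, Tendsto (fun n => ⟪c, u n⟫_ℝ) atTop (𝓝 ⟪c, l⟫_ℝ)) :
    Tendsto u atTop (𝓝 l) := by
  have h1 : Tendsto (fun n => (WithLp.ofLp (u n))) atTop (𝓝 (WithLp.ofLp l)) := by
    rw [tendsto_pi_nhds]
    intro i
    simpa [EuclideanSpace.inner_single_left] using h (EuclideanSpace.single i 1)
  exact ((PiLp.continuous_toLp 2 _).tendsto _).comp h1

/-- Each component of the primitive at `t` is the `L²` pairing with an indicator of `(-∞, t)`, so
weak convergence gives pointwise convergence. -/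
lemma tendsto_primitive {v : ℕ → Lp Plane 2 (volume.restrict (Ioo 0 T))}
    {w : Lp Plane 2 (volume.restrict (Ioo 0 T))}
    (h : ∀ g, Tendsto (fun n => ⟪g, v n⟫_ℝ) atTop (𝓝 ⟪g, w⟫_ℝ)) (t : ℝ) :
    Tendsto (fun n => primitive T (v n) t) atTop (𝓝 (primitive T w t)) := by
  refine tendsto_plane fun c => ?_
  have hμ : (volume.restrict (Ioo 0 T)) (Iio t) ≠ ⊤ := measure_ne_top _ _
  have := h (indicatorConstLp 2 (measurableSet_Iio (a := t)) hμ c)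
  simpa only [L2.inner_indicatorConstLp_eq_inner_setIntegral, primitive] using this

/-- Bounded sequences in `H¹_T` have subsequences that converge uniformly and whose velocities
converge weakly in `L²`. -/
lemma exists_subseq_tendsto (hT : 0 < T) (u : ℕ → ℝ → Plane) (hu : ∀ n, u n ∈ H1Loop T)
    (R R' : ℝ) (hR : ∀ n, ‖velocity (hu n)‖ ≤ R) (hR' : ∀ n, ‖u n 0‖ ≤ R') :
    ∃ (x : ℝ → Plane) (hx : x ∈ H1Loop T) (φ : ℕ → ℕ), StrictMono φ ∧
      TendstoUniformlyOn (fun n => u (φ n)) x atTop (Icc 0 T) ∧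
      ∀ g, Tendsto (fun n => ⟪g, velocity (hu (φ n))⟫_ℝ) atTop (𝓝 ⟪g, velocity hx⟫_ℝ) := by
  -- A finite exponent is needed for the separability of `L²`.
  have : Fact ((2 : ℝ≥0∞) ≠ ⊤) := ⟨by norm_num⟩
  obtain ⟨v, φ₁, hφ₁, hv⟩ := exists_subseq_tendsto_inner (fun n => velocity (hu n)) R hR
  obtain ⟨c, -, φ₂, hφ₂, hc⟩ := tendsto_subseq_of_bounded (x := fun n => u (φ₁ n) 0)
    (Metric.isBounded_closedBall (x := (0 : Plane)) (r := R')) (fun n => by simpa using hR' _)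
  set φ : ℕ → ℕ := fun n => φ₁ (φ₂ n) with hφ
  have hv' : ∀ g, Tendsto (fun n => ⟪g, velocity (hu (φ n))⟫_ℝ) atTop (𝓝 ⟪g, v⟫_ℝ) := fun g =>
    (hv g).comp hφ₂.tendsto_atTop
  set x : ℝ → Plane := fun t => c + primitive T v t with hxdef
  have hpt : ∀ t ∈ Icc 0 T, Tendsto (fun n => u (φ n) t) atTop (𝓝 (x t)) := by
    intro t ht
    refine (hc.add (tendsto_primitive hv' t)).congr fun n => ?_
    exact (eq_primitive_velocity hT (hu (φ n)) ht).symm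
  have h0 : (0 : ℝ) ∈ Icc 0 T := ⟨le_rfl, hT.le⟩
  have h1 : T ∈ Icc 0 T := ⟨hT.le, le_rfl⟩
  have hw : IsWeakDeriv T x v := isWeakDeriv_of_eq_primitive (Lp.memLp v) c fun _ _ => rfl
  have hx : x ∈ H1Loop T := by
    refine ⟨(continuous_const.add (continuous_primitive v)).continuousOn, ?_, v, hw⟩
    refine tendsto_nhds_unique (hpt 0 h0) ((hpt T h1).congr fun n => ?_)
    exact (hu (φ n)).2.1.symm
  have hvel : velocity hx = v := by
    refine Lp.ext ((velocity_ae_eq hx).trans ?_)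
    exact (isWeakDeriv_weakDeriv hx).ae_eq hw
  refine ⟨x, hx, φ, hφ₁.comp hφ₂, ?_, by rwa [hvel]⟩
  -- The common Hölder bound makes the sequence equicontinuous, which upgrades pointwise to locally
  -- uniform convergence; compactness of `[0, T]` does the rest.
  rw [← tendstoLocallyUniformlyOn_iff_tendstoUniformlyOn_of_compact isCompact_Icc,
    Metric.tendstoLocallyUniformlyOn_iff]
  intro ε hε t₀ ht₀
  have hcont : Tendsto (fun t => √|t - t₀| * R + √|t - t₀| * ‖v‖) (𝓝 t₀) (𝓝 0) := by
    have : Continuous fun t => √|t - t₀| * R + √|t - t₀| * ‖v‖ := by fun_prop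
    simpa using this.tendsto t₀
  refine ⟨{t | √|t - t₀| * R + √|t - t₀| * ‖v‖ < ε / 2} ∩ Icc 0 T,
    inter_mem (mem_nhdsWithin_of_mem_nhds (hcont.eventually_lt_const (by linarith)))
      self_mem_nhdsWithin, ?_⟩
  filter_upwards [Metric.tendsto_nhds.1 (hpt t₀ ht₀) (ε / 2) (by linarith)] with n hn t ht
  have e1 : ‖u (φ n) t - u (φ n) t₀‖ ≤ √|t - t₀| * R :=
    (norm_sub_le_velocity hT (hu (φ n)) ht₀ ht.2).trans
      (mul_le_mul_of_nonneg_left (hR _) (Real.sqrt_nonneg _))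
  have e2 : ‖x t - x t₀‖ ≤ √|t - t₀| * ‖v‖ := by
    rw [hxdef]; simp only [add_sub_add_left_eq_sub]
    exact norm_primitive_sub_le v t₀ t
  have e3 := ht.1
  simp only [mem_ofPred_eq] at e3
  rw [dist_eq_norm] at hn ⊢
  calc ‖x t - u (φ n) t‖
      = ‖(x t - x t₀) - (u (φ n) t₀ - x t₀) - (u (φ n) t - u (φ n) t₀)‖ := by congr 1; abel
    _ ≤ ‖x t - x t₀‖ + ‖u (φ n) t₀ - x t₀‖ + ‖u (φ n) t - u (φ n) t₀‖ :=
        (norm_sub_le _ _).trans (add_le_add_left (norm_sub_le _ _) _)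
    _ < ε := by linarith

/-! ### Polar angles and winding numbers -/

/-- The unit vector with polar angle `θ`. -/
noncomputable def unitVector (θ : ℝ) : Plane := !₂[Real.cos θ, Real.sin θ]

lemma norm_unitVector (θ : ℝ) : ‖unitVector θ‖ = 1 := by
  simp [unitVector, EuclideanSpace.norm_eq]

lemma norm_plane (a : Plane) : ‖a‖ = √(a 0 ^ 2 + a 1 ^ 2) := by
  simp [EuclideanSpace.norm_eq]

lemma unitVector_add_pi (θ : ℝ) : unitVector (θ + Real.pi) = -unitVector θ := by
  ext i; fin_cases i <;> simp [unitVector]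

lemma unitVector_sub_pi (θ : ℝ) : unitVector (θ - Real.pi) = -unitVector θ := by
  ext i; fin_cases i <;> simp [unitVector]

lemma inner_unitVector (θ : ℝ) (a : Plane) :
    ⟪unitVector θ, a⟫_ℝ = Real.cos θ * a 0 + Real.sin θ * a 1 := by
  simp [unitVector, PiLp.inner_apply, Fin.sum_univ_two, mul_comm]

/-- A vector on the same side as `unitVector θ` is obtained by rotating by an arctangent. -/
lemma eq_norm_smul_unitVector_add_arctan (θ : ℝ) (a : Plane) (ha : 0 < ⟪unitVector θ, a⟫_ℝ) :
    a = ‖a‖ • unitVector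
      (θ + Real.arctan ((Real.cos θ * a 1 - Real.sin θ * a 0) / ⟪unitVector θ, a⟫_ℝ)) := by
  rw [inner_unitVector] at ha ⊢
  -- `p` and `q` are the coordinates of `a` in the frame rotated by `θ`.
  set p := Real.cos θ * a 0 + Real.sin θ * a 1 with hp
  set q := Real.cos θ * a 1 - Real.sin θ * a 0 with hq
  have hcs := Real.sin_sq_add_cos_sq θ
  have hnorm : ‖a‖ = √(p ^ 2 + q ^ 2) := by
    rw [norm_plane]; congr 1
    rw [hp, hq]
    linear_combination (-(a 0 ^ 2) - a 1 ^ 2) * hcs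
  have hsq : √(1 + (q / p) ^ 2) = ‖a‖ / p := by
    rw [hnorm, ← Real.sqrt_sq ha.le, ← Real.sqrt_div' _ (sq_nonneg p), Real.sqrt_sq ha.le]
    congr 1; field_simp
  have hpos : 0 < ‖a‖ := by rw [hnorm]; positivity
  have hcos : ‖a‖ * Real.cos (Real.arctan (q / p)) = p := by
    rw [Real.cos_arctan, hsq]; field_simp
  have hsin : ‖a‖ * Real.sin (Real.arctan (q / p)) = q := by
    rw [Real.sin_arctan, hsq]; field_simp
  ext i
  fin_cases i
  · simp only [unitVector, Real.cos_add, Real.sin_add, PiLp.smul_apply, smul_eq_mul, Fin.zero_eta,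
      Matrix.cons_val_zero]
    linear_combination (-(a 0)) * hcs - Real.cos θ * hcos + Real.sin θ * hsin
      + Real.cos θ * hp - Real.sin θ * hq
  · simp only [unitVector, Real.cos_add, Real.sin_add, PiLp.smul_apply, smul_eq_mul, Fin.mk_one,
      Matrix.cons_val_one, Matrix.cons_val_fin_one]
    linear_combination (-(a 1)) * hcs - Real.sin θ * hcos - Real.cos θ * hsin
      + Real.sin θ * hp + Real.cos θ * hq

lemma IsPolarAngle.unitVector_eq {θ : ℝ → ℝ} (hT : 0 < T) (hx : x 0 = x T) (h0 : x 0 ≠ 0)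
    (hθ : IsPolarAngle T x θ) : unitVector (θ T) = unitVector (θ 0) := by
  have h1 : x 0 = ‖x 0‖ • unitVector (θ 0) := hθ.2 0 ⟨le_rfl, hT.le⟩
  have h2 : x T = ‖x T‖ • unitVector (θ T) := hθ.2 T ⟨hT.le, le_rfl⟩
  rw [← hx, h1, ← h1] at h2
  exact smul_right_injective Plane (norm_ne_zero_iff.2 h0) (h2.symm.trans h1)

/-- Loops close to a loop with nonzero winding number have nonzero winding number. -/
lemma mem_windingLoops_of_close (hT : 0 < T) {y : ℝ → Plane} (hy : y ∈ windingLoops T)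
    (hx : x ∈ H1Loop T) (hx0 : ∀ t ∈ Icc 0 T, x t ≠ 0)
    (hxy : ∀ t ∈ Icc 0 T, ‖x t - y t‖ < ‖y t‖) : x ∈ windingLoops T := by
  obtain ⟨hyL, hy0, r, ⟨θ, hθ, hr⟩, hr0⟩ := hy
  have h0 : (0 : ℝ) ∈ Icc 0 T := ⟨le_rfl, hT.le⟩
  -- Since `x t` is closer to `y t` than the origin is, it stays in the open half-plane around the
  -- direction of `y t`.
  have hpos : ∀ t ∈ Icc 0 T, 0 < ⟪unitVector (θ t), x t⟫_ℝ := by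
    intro t ht
    have h1 : y t = ‖y t‖ • unitVector (θ t) := hθ.2 t ht
    have h2 : ⟪unitVector (θ t), y t⟫_ℝ = ‖y t‖ := by
      conv_lhs => rw [h1]
      rw [inner_smul_right, real_inner_self_eq_norm_sq, norm_unitVector]; simp
    have h3 := neg_le_of_abs_le (abs_real_inner_le_norm (unitVector (θ t)) (x t - y t))
    rw [norm_unitVector, one_mul, inner_sub_right, h2] at h3
    linarith [hxy t ht]
  set ψ : ℝ → ℝ := fun t => θ t + Real.arctan
    ((Real.cos (θ t) * x t 1 - Real.sin (θ t) * x t 0) / ⟪unitVector (θ t), x t⟫_ℝ) with hψ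
  have hxi : ∀ i : Fin 2, ContinuousOn (fun t => x t i) (Icc 0 T) := fun i =>
    (EuclideanSpace.proj (𝕜 := ℝ) i).continuous.comp_continuousOn hx.1
  have hcos := Real.continuous_cos.comp_continuousOn hθ.1
  have hsin := Real.continuous_sin.comp_continuousOn hθ.1
  have hψp : IsPolarAngle T x ψ := by
    refine ⟨hθ.1.add (Real.continuous_arctan.comp_continuousOn (ContinuousOn.div
      ((hcos.mul (hxi 1)).sub (hsin.mul (hxi 0))) ?_ fun t ht => (hpos t ht).ne')), fun t ht =>
      eq_norm_smul_unitVector_add_arctan _ _ (hpos t ht)⟩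
    simp only [inner_unitVector]
    exact (hcos.mul (hxi 0)).add (hsin.mul (hxi 1))
  refine ⟨hx, hx0, _, ⟨ψ, hψp, rfl⟩, ?_⟩
  have hu := hθ.unitVector_eq hT hyL.2.1 (hy0 0 h0)
  have hc : Real.cos (θ T) = Real.cos (θ 0) := congrArg (fun a : Plane => a 0) hu
  have hs : Real.sin (θ T) = Real.sin (θ 0) := congrArg (fun a : Plane => a 1) hu
  have : ψ T - ψ 0 = θ T - θ 0 := by
    -- The arctangent correction depends only on `x` and on the cosine and sine of `θ`, so it agrees
    -- at both ends and cancels.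
    simp only [hψ, hu, hc, hs, ← hx.2.1]; ring
  rwa [this, ← hr]

/-- The class of loops is closed under uniform convergence within `H¹_T`. -/
lemma mem_loopClass_of_tendstoUniformlyOn (hT : 0 < T) {u : ℕ → ℝ → Plane}
    (hu : ∀ n, u n ∈ loopClass T) (hx : x ∈ H1Loop T)
    (h : TendstoUniformlyOn u x atTop (Icc 0 T)) : x ∈ loopClass T := by
  by_cases hz : ∃ t ∈ Icc 0 T, x t = 0
  · exact Or.inl ⟨hx, hz⟩
  push Not at hz
  obtain ⟨t₀, ht₀, hmin⟩ := isCompact_Icc.exists_isMinOn ⟨0, le_rfl, hT.le⟩ hx.1.norm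
  -- Within half the minimal modulus of `x`, the approximant has modulus larger than its distance to
  -- `x`; in particular it has no zeros.
  have hm : 0 < ‖x t₀‖ / 2 := half_pos (norm_pos_iff.2 (hz t₀ ht₀))
  obtain ⟨n, hn⟩ := (Metric.tendstoUniformlyOn_iff.1 h _ hm).exists
  have hlt : ∀ t ∈ Icc 0 T, ‖x t - u n t‖ < ‖u n t‖ := by
    intro t ht
    have h1 := hn t ht
    rw [dist_eq_norm] at h1
    have h2 : ‖x t₀‖ ≤ ‖x t‖ := hmin ht
    have h3 := norm_sub_norm_le (x t) (x t - u n t)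
    rw [sub_sub_cancel] at h3
    linarith
  rcases hu n with hc | hw
  · obtain ⟨-, t, ht, h0⟩ := hc
    have := hlt t ht
    rw [h0, norm_zero] at this
    exact absurd this (not_lt.2 (norm_nonneg _))
  · exact Or.inr (mem_windingLoops_of_close hT hw hx hz hlt)

lemma mem_H1Loop_of_mem_loopClass (hx : x ∈ loopClass T) : x ∈ H1Loop T :=
  hx.elim (fun h => h.1) fun h => h.1

/-- A loop with nonzero winding number meets the half-line opposite to its starting point. -/
lemma exists_eq_neg_smul_of_mem_windingLoops (hT : 0 < T) (hx : x ∈ windingLoops T) :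
    ∃ t ∈ Icc 0 T, ‖x 0‖ ≤ ‖x 0 - x t‖ := by
  obtain ⟨hxL, hx0, r, ⟨θ, hθ, hr⟩, hr0⟩ := hx
  have h0 : (0 : ℝ) ∈ Icc 0 T := ⟨le_rfl, hT.le⟩
  have hu := hθ.unitVector_eq hT hxL.2.1 (hx0 0 h0)
  have hc : Real.cos (θ T) = Real.cos (θ 0) := congrArg (fun a : Plane => a 0) hu
  have hs : Real.sin (θ T) = Real.sin (θ 0) := congrArg (fun a : Plane => a 1) hu
  obtain ⟨k, hk⟩ := Real.Angle.angle_eq_iff_two_pi_dvd_sub.1 (Real.Angle.cos_sin_inj hc hs)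
  have hpi := Real.pi_pos
  have hk0 : k ≠ 0 := by
    rintro rfl
    simp only [Int.cast_zero, mul_zero] at hk
    rw [hk, zero_div] at hr
    exact hr0 hr
  have hivt : uIcc (θ 0) (θ T) ⊆ θ '' uIcc 0 T :=
    intermediate_value_uIcc (by rw [uIcc_of_le hT.le]; exact hθ.1)
  rw [uIcc_of_le hT.le] at hivt
  -- The angle changes by a nonzero multiple of `2π`, so it passes through `θ 0 ± π`.
  have hopp : ∃ t ∈ Icc 0 T, unitVector (θ t) = -unitVector (θ 0) := by
    rcases lt_or_gt_of_ne hk0 with h | h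
    · have h1 : (k : ℝ) ≤ -1 := by exact_mod_cast Int.le_sub_one_of_lt h
      obtain ⟨t, ht, e⟩ := hivt (show θ 0 - Real.pi ∈ uIcc (θ 0) (θ T) from
        mem_uIcc.2 (Or.inr ⟨by nlinarith, by linarith⟩))
      exact ⟨t, ht, by rw [e, unitVector_sub_pi]⟩
    · have h1 : (1 : ℝ) ≤ k := by exact_mod_cast h
      obtain ⟨t, ht, e⟩ := hivt (show θ 0 + Real.pi ∈ uIcc (θ 0) (θ T) from
        mem_uIcc.2 (Or.inl ⟨by linarith, by nlinarith⟩))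
      exact ⟨t, ht, by rw [e, unitVector_add_pi]⟩
  obtain ⟨t, ht, e⟩ := hopp
  refine ⟨t, ht, ?_⟩
  have h1 : x 0 = ‖x 0‖ • unitVector (θ 0) := hθ.2 0 h0
  have h2 : x t = ‖x t‖ • unitVector (θ t) := hθ.2 t ht
  have h3 : x 0 - x t = (‖x 0‖ + ‖x t‖) • unitVector (θ 0) := by
    conv_lhs => rw [h1, h2, e]
    rw [smul_neg, sub_neg_eq_add, add_smul]
  rw [h3, norm_smul, norm_unitVector, mul_one, Real.norm_of_nonneg (by positivity)]
  exact le_add_of_nonneg_right (norm_nonneg _)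

/-- On the class of loops the supremum norm is controlled by the velocity. -/
lemma norm_le_velocity (hT : 0 < T) (hx : x ∈ loopClass T) {t : ℝ} (ht : t ∈ Icc 0 T) :
    ‖x t‖ ≤ 2 * √T * ‖velocity (mem_H1Loop_of_mem_loopClass hx)‖ := by
  have hL := mem_H1Loop_of_mem_loopClass hx
  have h0 : (0 : ℝ) ∈ Icc 0 T := ⟨le_rfl, hT.le⟩
  have hx0 : ‖x 0‖ ≤ √T * ‖velocity hL‖ := by
    rcases hx with ⟨-, s, hs, e⟩ | hw
    · have := norm_sub_le_sqrt_mul_velocity hT hL hs h0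
      rwa [e, sub_zero] at this
    · obtain ⟨s, hs, e⟩ := exists_eq_neg_smul_of_mem_windingLoops hT hw
      exact e.trans (norm_sub_le_sqrt_mul_velocity hT hL hs h0)
  have h1 := norm_sub_le_sqrt_mul_velocity hT hL h0 ht
  have h2 := norm_le_norm_add_norm_sub' (x t) (x 0)
  linarith

/-! ### The action and its real sublevels -/

lemma lintegral_enorm_weakDeriv (hx : x ∈ H1Loop T) :
    ∫⁻ t in Ioo 0 T, ‖weakDeriv T x t‖ₑ ^ 2 / 2 = ENNReal.ofReal (‖velocity hx‖ ^ 2 / 2) := by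
  have h1 : ∫⁻ t in Ioo 0 T, ‖weakDeriv T x t‖ₑ ^ 2 = ENNReal.ofReal (‖velocity hx‖ ^ 2) := by
    rw [ENNReal.ofReal_pow (norm_nonneg _), velocity, Lp.norm_toLp,
      ENNReal.ofReal_toReal (isWeakDeriv_weakDeriv hx).1.eLpNorm_ne_top,
      eLpNorm_eq_lintegral_rpow_enorm_toReal (by norm_num) (by norm_num), ← ENNReal.rpow_natCast,
      ← ENNReal.rpow_mul]
    norm_num
  simp only [div_eq_mul_inv]
  rw [lintegral_mul_const' _ _ (by norm_num), h1, ENNReal.ofReal_mul (by positivity),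
    ENNReal.ofReal_inv_of_pos (by norm_num), ENNReal.ofReal_ofNat]

/-- The Keplerian part `∫ 1/|x|` of the action. -/
noncomputable def keplerIntegral (T : ℝ) (x : ℝ → Plane) : ℝ≥0∞ :=
  ∫⁻ t in Ioo 0 T, ‖x t‖ₑ⁻¹

lemma action_eq (U : ℝ × Plane → ℝ) (hx : x ∈ H1Loop T) :
    action T U x = ((ENNReal.ofReal (‖velocity hx‖ ^ 2 / 2) + keplerIntegral T x : ℝ≥0∞) : EReal)
      + ((∫ t in Ioo 0 T, U (t, x t) : ℝ) : EReal) := by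
  have hm : AEMeasurable (fun t => ‖weakDeriv T x t‖ₑ ^ 2 / 2) (volume.restrict (Ioo 0 T)) :=
    ((isWeakDeriv_weakDeriv hx).1.1.enorm.pow_const 2).div_const 2
  rw [action, lintegral_add_left' hm, lintegral_enorm_weakDeriv hx, keplerIntegral]

/-- Separates the kinetic and Keplerian bounds so that limits can be taken in `ℝ` and `ℝ≥0∞`. The
first conjunct guards against `ENNReal.ofReal` truncating a negative number to zero. -/
lemma action_le_coe_iff (U : ℝ × Plane → ℝ) (hx : x ∈ H1Loop T) (c : ℝ) :
    action T U x ≤ c ↔ ‖velocity hx‖ ^ 2 / 2 ≤ c - ∫ t in Ioo 0 T, U (t, x t) ∧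
      keplerIntegral T x ≤
        ENNReal.ofReal (c - (∫ t in Ioo 0 T, U (t, x t)) - ‖velocity hx‖ ^ 2 / 2) := by
  rw [action_eq U hx]
  set G := ∫ t in Ioo 0 T, U (t, x t)
  set A := ‖velocity hx‖ ^ 2 / 2
  have hA : 0 ≤ A := by positivity
  rw [← EReal.le_sub_iff_add_le (Or.inl (EReal.coe_ne_bot G)) (Or.inl (EReal.coe_ne_top G)),
    ← EReal.coe_sub]
  constructor
  · intro h
    have h0 : 0 ≤ c - G := by
      have := (EReal.coe_ennreal_nonneg _).trans h
      exact_mod_cast this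
    have h1 : ((ENNReal.ofReal (c - G) : ℝ≥0∞) : EReal) = ((c - G : ℝ) : EReal) := by
      rw [EReal.coe_ennreal_ofReal, max_eq_left h0]
    rw [← h1, EReal.coe_ennreal_le_coe_ennreal_iff] at h
    refine ⟨(ENNReal.ofReal_le_ofReal_iff h0).1 (le_self_add.trans h), ?_⟩
    rw [ENNReal.ofReal_sub _ hA]
    exact ENNReal.le_sub_of_add_le_left ENNReal.ofReal_ne_top h
  · rintro ⟨h1, h2⟩
    have h0 : 0 ≤ c - G := hA.trans h1
    have h3 : ((ENNReal.ofReal (c - G) : ℝ≥0∞) : EReal) = ((c - G : ℝ) : EReal) := by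
      rw [EReal.coe_ennreal_ofReal, max_eq_left h0]
    rw [← h3, EReal.coe_ennreal_le_coe_ennreal_iff]
    calc ENNReal.ofReal A + keplerIntegral T x
        ≤ ENNReal.ofReal A + ENNReal.ofReal (c - G - A) := by gcongr
      _ = ENNReal.ofReal (c - G) := by
          rw [← ENNReal.ofReal_add hA (sub_nonneg.2 h1)]; congr 1; ring

/-! ### Subquadratic growth and coercivity -/

lemma abs_le_of_growth {U : ℝ × Plane → ℝ} {C α M : ℝ} (hC : 0 < C) (hα : 0 < α)
    (hgrowth : ∀ (t : ℝ) (x : Plane), |U (t, x)| ≤ C * (1 + ‖x‖ ^ α)) (t : ℝ) {a : Plane}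
    (ha : ‖a‖ ≤ M) : |U (t, a)| ≤ C * (1 + M ^ α) := by
  refine (hgrowth t a).trans ?_
  gcongr

lemma exists_bound_of_subquadratic {α : ℝ} (hα : α < 2) (a b k : ℝ) (hk : 0 ≤ k)
    (hb : 0 ≤ b) : ∃ R, ∀ s, 0 ≤ s → s ^ 2 / 2 ≤ a + b * (1 + (k * s) ^ α) → s ≤ R := by
  -- This threshold makes `b * k ^ α * s ^ α ≤ s ^ 2 / 4` for large `s`, leaving `s ^ 2 ≤ 4 * (a +
  -- b)`; the `+ 1` keeps the denominator positive when `b * k ^ α = 0`.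
  have hδ : 0 < 1 / (4 * (b * k ^ α + 1)) := by positivity
  obtain ⟨s₀, hs₀⟩ := eventually_atTop.1
    (((tendsto_rpow_neg_atTop (sub_pos.2 hα)).eventually_le_const hδ).and (eventually_gt_atTop 0))
  refine ⟨max s₀ (1 + 4 * |a + b|), fun s hs h => ?_⟩
  by_contra hn
  rw [not_le, max_lt_iff] at hn
  obtain ⟨h1, hspos⟩ := hs₀ s hn.1.le
  have h2 : s ^ α ≤ s ^ 2 / (4 * (b * k ^ α + 1)) := by
    have := mul_le_mul_of_nonneg_left h1 (sq_nonneg s)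
    rwa [← Real.rpow_two, ← Real.rpow_add hspos, Real.rpow_two, mul_one_div,
      show 2 + -(2 - α) = α by ring] at this
  rw [le_div_iff₀ (by positivity)] at h2
  rw [Real.mul_rpow hk hs] at h
  have h3 : 0 ≤ s ^ α := by positivity
  have h4 := le_abs_self (a + b)
  have h5 := abs_nonneg (a + b)
  nlinarith [hn.2]

lemma continuousOn_potential {U : ℝ × Plane → ℝ} (hU : Continuous U)
    (hx : ContinuousOn x (Icc 0 T)) :
    ContinuousOn (fun t => U (t, x t)) (Icc 0 T) :=
  hU.comp_continuousOn (continuousOn_id.prodMk hx)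

/-- Sublevels of the action are bounded in `H¹`. -/
lemma exists_velocity_bound (hT : 0 < T) {U : ℝ × Plane → ℝ} {C α : ℝ}
    (hC : 0 < C) (hα : α ∈ Ioo (0 : ℝ) 2)
    (hgrowth : ∀ (t : ℝ) (x : Plane), |U (t, x)| ≤ C * (1 + ‖x‖ ^ α)) (c : ℝ) :
    ∃ R, ∀ x, ∀ hx : x ∈ loopClass T, action T U x ≤ c →
      ‖velocity (mem_H1Loop_of_mem_loopClass hx)‖ ≤ R := by
  obtain ⟨R, hR⟩ := exists_bound_of_subquadratic hα.2 c (C * T) (2 * √T) (by positivity)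
    (by positivity)
  refine ⟨R, fun x hx h => hR _ (norm_nonneg _) ?_⟩
  have h1 := ((action_le_coe_iff U (mem_H1Loop_of_mem_loopClass hx) c).1 h).1
  have h2 : ‖∫ t in Ioo 0 T, U (t, x t)‖ ≤
      C * (1 + (2 * √T * ‖velocity (mem_H1Loop_of_mem_loopClass hx)‖) ^ α)
        * volume.real (Ioo 0 T) :=
    norm_setIntegral_le_of_norm_le_const (by simp) fun t ht =>
      abs_le_of_growth hC hα.1 hgrowth t (norm_le_velocity hT hx (Ioo_subset_Icc_self ht))
  rw [Real.volume_real_Ioo_of_le hT.le, sub_zero] at h2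
  have h3 := neg_le_of_abs_le h2
  linarith

/-! ### Lower semicontinuity -/

lemma tendsto_integral_potential {U : ℝ × Plane → ℝ} (hU : Continuous U) {C α M : ℝ}
    (hC : 0 < C) (hα : 0 < α)
    (hgrowth : ∀ (t : ℝ) (x : Plane), |U (t, x)| ≤ C * (1 + ‖x‖ ^ α)) {u : ℕ → ℝ → Plane}
    (hu : ∀ n, ContinuousOn (u n) (Icc 0 T)) (hM : ∀ n, ∀ t ∈ Icc 0 T, ‖u n t‖ ≤ M)
    (h : ∀ t ∈ Icc 0 T, Tendsto (fun n => u n t) atTop (𝓝 (x t))) :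
    Tendsto (fun n => ∫ t in Ioo 0 T, U (t, u n t)) atTop (𝓝 (∫ t in Ioo 0 T, U (t, x t))) := by
  refine tendsto_integral_of_dominated_convergence (fun _ => C * (1 + M ^ α)) (fun n => ?_)
    (integrable_const _) (fun n => ?_) ?_
  · exact ((continuousOn_potential hU (hu n)).mono Ioo_subset_Icc_self).aestronglyMeasurable
      measurableSet_Ioo
  · refine (ae_restrict_iff' measurableSet_Ioo).2 (Eventually.of_forall fun t ht => ?_)
    exact abs_le_of_growth hC hα hgrowth t (hM n t (Ioo_subset_Icc_self ht))
  · refine (ae_restrict_iff' measurableSet_Ioo).2 (Eventually.of_forall fun t ht => ?_)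
    exact (hU.tendsto _).comp (tendsto_const_nhds.prodMk_nhds (h t (Ioo_subset_Icc_self ht)))

lemma keplerIntegral_le_liminf {u : ℕ → ℝ → Plane}
    (hu : ∀ n, ContinuousOn (u n) (Icc 0 T))
    (h : ∀ t ∈ Icc 0 T, Tendsto (fun n => u n t) atTop (𝓝 (x t))) :
    keplerIntegral T x ≤ liminf (fun n => keplerIntegral T (u n)) atTop := by
  have hm : ∀ n, AEMeasurable (fun t => ‖u n t‖ₑ⁻¹) (volume.restrict (Ioo 0 T)) := fun n =>
    (((hu n).mono Ioo_subset_Icc_self).aestronglyMeasurable measurableSet_Ioo).enorm.inv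
  refine le_trans (lintegral_mono_ae ?_) (lintegral_liminf_le' hm)
  refine (ae_restrict_iff' measurableSet_Ioo).2 (Eventually.of_forall fun t ht => ?_)
  have h1 : Tendsto (fun n => ‖u n t‖ₑ⁻¹) atTop (𝓝 ‖x t‖ₑ⁻¹) :=
    (h t (Ioo_subset_Icc_self ht)).enorm.inv
  exact h1.liminf_eq.ge

/-- Sublevels of the action are closed under uniform convergence with weakly convergent
velocities. -/
lemma action_le_of_tendsto {U : ℝ × Plane → ℝ} {u : ℕ → ℝ → Plane}
    (hu : ∀ n, u n ∈ H1Loop T) (hx : x ∈ H1Loop T)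
    (h : ∀ t ∈ Icc 0 T, Tendsto (fun n => u n t) atTop (𝓝 (x t)))
    (hG : Tendsto (fun n => ∫ t in Ioo 0 T, U (t, u n t)) atTop
      (𝓝 (∫ t in Ioo 0 T, U (t, x t))))
    (hv : Tendsto (fun n => ⟪velocity hx, velocity (hu n)⟫_ℝ) atTop
      (𝓝 ⟪velocity hx, velocity hx⟫_ℝ)) (c : ℝ)
    (hc : ∀ᶠ n in atTop, action T U (u n) ≤ c) : action T U x ≤ c := by
  set v := velocity hx
  have hs : Tendsto (fun n => ⟪v, velocity (hu n)⟫_ℝ - ‖v‖ ^ 2 / 2) atTop (𝓝 (‖v‖ ^ 2 / 2)) := by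
    have := hv.sub_const (‖v‖ ^ 2 / 2)
    rwa [real_inner_self_eq_norm_sq, sub_half] at this
  -- The tangent-plane bound for the convex function `‖·‖ ^ 2 / 2` at `v`. Its left side is affine
  -- in the velocity, so it passes to the weak limit; it is used in both halves below.
  have hle : ∀ n, ⟪v, velocity (hu n)⟫_ℝ - ‖v‖ ^ 2 / 2 ≤ ‖velocity (hu n)‖ ^ 2 / 2 := by
    intro n
    have := norm_sub_sq_real v (velocity (hu n))
    nlinarith [sq_nonneg ‖v - velocity (hu n)‖]
  have hGc : Tendsto (fun n => c - ∫ t in Ioo 0 T, U (t, u n t)) atTop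
      (𝓝 (c - ∫ t in Ioo 0 T, U (t, x t))) := hG.const_sub c
  rw [action_le_coe_iff U hx]
  constructor
  · refine le_of_tendsto_of_tendsto hs hGc (hc.mono fun n hn => ?_)
    exact (hle n).trans ((action_le_coe_iff U (hu n) c).1 hn).1
  · refine (keplerIntegral_le_liminf (fun n => (hu n).1) h).trans ?_
    have hlim := (ENNReal.continuous_ofReal.tendsto _).comp (hGc.sub hs)
    rw [← hlim.liminf_eq]
    refine liminf_le_liminf (hc.mono fun n hn => ?_)
    refine ((action_le_coe_iff U (hu n) c).1 hn).2.trans (ENNReal.ofReal_le_ofReal ?_)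
    linarith [hle n]

lemma zero_mem_loopClass (hT : 0 < T) : (fun _ => 0) ∈ loopClass T :=
  Or.inl ⟨⟨continuousOn_const, rfl, 0, MemLp.zero, fun _ _ _ _ => by simp⟩, 0, ⟨le_rfl, hT.le⟩, rfl⟩

end ForcedKepler

/-! ### Existence of a minimizer -/

open ForcedKepler Filter Topology in
theorem theorem2p2 (T : ℝ) (hT : 0 < T)
    (U : ℝ × ForcedKepler.Plane → ℝ) (hU : ContDiff ℝ 1 U)
    (hper : ∀ (t : ℝ) (x : ForcedKepler.Plane), U (t + T, x) = U (t, x))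
    (C α : ℝ) (hC : 0 < C) (hα : α ∈ Set.Ioo (0 : ℝ) 2)
    (hgrowth : ∀ (t : ℝ) (x : ForcedKepler.Plane), |U (t, x)| ≤ C * (1 + ‖x‖ ^ α)) :
    ∃ x ∈ ForcedKepler.loopClass T,
      ∀ y ∈ ForcedKepler.loopClass T,
        ForcedKepler.action T U x ≤ ForcedKepler.action T U y := by
  set S : Set EReal := action T U '' loopClass T
  have hle : ∀ y ∈ loopClass T, sInf S ≤ action T U y := fun y hy => sInf_le ⟨y, hy, rfl⟩
  -- If the infimum were `⊤`, every loop would be a minimizer, so no loop of finite action has to be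
  -- exhibited.
  by_cases htop : sInf S = ⊤
  · refine ⟨_, zero_mem_loopClass hT, fun y hy => ?_⟩
    exact le_top.trans (htop.symm.le.trans (hle y hy))
  obtain ⟨c, hc, -⟩ := EReal.lt_iff_exists_real_btwn.1 (lt_top_iff_ne_top.2 htop)
  obtain ⟨a, -, ha, haS⟩ := exists_seq_tendsto_sInf (S := S) ⟨_, _, zero_mem_loopClass hT, rfl⟩
    (OrderBot.bddBelow S)
  obtain ⟨N, hN⟩ := eventually_atTop.1 (ha.eventually_lt_const hc)
  choose y hy hya using haS
  -- Dropping the first `N` terms puts the whole sequence below the real level `c`, where the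
  -- velocity bound applies.
  set u : ℕ → ℝ → Plane := fun n => y (n + N) with hu_def
  have hu : ∀ n, u n ∈ loopClass T := fun n => hy _
  have hulim : Tendsto (fun n => action T U (u n)) atTop (𝓝 (sInf S)) := by
    simp only [hu_def, hya]
    exact (tendsto_add_atTop_iff_nat N).2 ha
  have huL : ∀ n, u n ∈ H1Loop T := fun n => mem_H1Loop_of_mem_loopClass (hu n)
  obtain ⟨R, hR⟩ := exists_velocity_bound hT hC hα hgrowth c
  have huR : ∀ n, ‖velocity (huL n)‖ ≤ R := fun n => hR _ (hu n) (by
    simp only [hu_def, hya]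
    exact (hN _ (Nat.le_add_left _ _)).le)
  have huM : ∀ n, ∀ t ∈ Icc 0 T, ‖u n t‖ ≤ 2 * √T * R := fun n t ht =>
    (norm_le_velocity hT (hu n) ht).trans (mul_le_mul_of_nonneg_left (huR n) (by positivity))
  obtain ⟨x, hx, φ, hφ, hunif, hweak⟩ := exists_subseq_tendsto hT u huL R (2 * √T * R) huR
    fun n => huM n 0 ⟨le_rfl, hT.le⟩
  have hpt : ∀ t ∈ Icc 0 T, Tendsto (fun n => u (φ n) t) atTop (𝓝 (x t)) := fun t ht =>
    hunif.tendsto_at ht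
  refine ⟨x, mem_loopClass_of_tendstoUniformlyOn hT (fun n => hu (φ n)) hx hunif, fun z hz => ?_⟩
  -- It suffices to bound the action of `x` by every real `b` above the infimum; the subsequence is
  -- eventually below each such `b`.
  refine le_trans (EReal.le_of_forall_lt_iff_le.1 fun b hb => ?_) (hle z hz)
  exact action_le_of_tendsto (fun n => huL (φ n)) hx hpt
    (tendsto_integral_potential hU.continuous hC hα.1 hgrowth (fun n => (huL (φ n)).1)
      (fun n => huM (φ n)) hpt) (hweak _) b
    ((hulim.comp hφ.tendsto_atTop).eventually_le_const hb)
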